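/- For all positive integers $r$, $s$, $t$, $n$ and any nonnegative integer $a$, the sum $$ \sum_{k=1}^n k^{2a+1}\binom{6n}{3n+k}^r\binom{4n}{2n+k}^s\binom{2n}{n+k}^t $$ is divisible by both $n\binom{6n}{n}$ and $3n\binom{6n}{3n}$. -/

import Mathlib

/-! Write P_s(k) = 1/((s+k)!(s-k)!), so that binom(2m, m+k) = (2m)! P_m(k). By Chu–Vandermonde, a
product P_l P_s is a combination of the P_u (`invFactorialPair_mul`). With the weights
1/((c-s)!(l-s)!), the coefficients become integers: multiplication by (l+l')! P_{l'} sends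
`weightedSpan c l` into `weightedSpan c l'`, and multiplication by k² preserves each span. Hence, up
to factorials, the summand is k times an integral combination of weighted P_s. Since ∑ k P_s(k) =
s/(2 s!²), each generator contributes s binom(c,s) binom(l,s)/2 after scaling by c! l!, and the
divisibility is read off there. The two claims differ only in the order in which the three binomials
are multiplied. -/

/-- The function `k ↦ 1 / ((s + k)! (s - k)!)`, extended by zero for `k > s`. -/
def invFactorialPair (s k : ℕ) : ℚ :=
  if k ≤ s then 1 / ((s + k).factorial * (s - k).factorial : ℚ) else 0

theorem invFactorialPair_of_lt {s k : ℕ} (h : s < k) : invFactorialPair s k = 0 :=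
  if_neg (not_le.2 h)

theorem invFactorialPair_add (j k : ℕ) :
    invFactorialPair (k + j) k = 1 / ((k + j + k).factorial * j.factorial : ℚ) := by
  simp [invFactorialPair]

theorem centralChoose_eq (m k : ℕ) :
    ((2 * m).choose (m + k) : ℚ) = (2 * m).factorial * invFactorialPair m k := by
  rcases le_or_gt k m with h | h
  · obtain ⟨j, rfl⟩ := Nat.exists_eq_add_of_le h
    rw [invFactorialPair_add, Nat.cast_choose ℚ (by omega),
      show 2 * (k + j) - (k + j + k) = j by omega, mul_one_div]
  · rw [invFactorialPair_of_lt h, Nat.choose_eq_zero_of_lt (by omega)]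
    simp

theorem invFactorialPair_succ (s k : ℕ) :
    ((s : ℚ) - k) * invFactorialPair s k = (s + k + 1) * invFactorialPair s (k + 1) := by
  rcases lt_trichotomy k s with h | h | h
  · obtain ⟨j, rfl⟩ := Nat.exists_eq_add_of_lt h
    rw [show k + j + 1 = k + (j + 1) by ring, invFactorialPair_add,
      show k + (j + 1) = (k + 1) + j by ring, invFactorialPair_add,
      show k + 1 + j + (k + 1) = (k + 1 + j + k) + 1 by ring, Nat.factorial_succ,
      Nat.factorial_succ]
    have h₁ := Nat.factorial_ne_zero (k + 1 + j + k)
    have h₂ := Nat.factorial_ne_zero j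
    push_cast
    field_simp
    ring
  · subst h
    rw [invFactorialPair_of_lt (Nat.lt_succ_self k)]
    simp
  · rw [invFactorialPair_of_lt h, invFactorialPair_of_lt (by omega : s < k + 1)]
    simp

/-- Telescoping: 2k = (s+k) - (s-k), and (s+k) P_s(k) = (s-k+1) P_s(k-1). -/
theorem sum_mul_invFactorialPair_eq (s K : ℕ) :
    ∑ k ∈ Finset.Icc 1 K, (k : ℚ) * invFactorialPair s k =
      (s * invFactorialPair s 0 - (s - K) * invFactorialPair s K) / 2 := by
  induction K with
  | zero => simp
  | succ K ih =>
    rw [Finset.sum_Icc_succ_top (by omega), ih, invFactorialPair_succ]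
    push_cast
    ring

theorem sum_mul_invFactorialPair {s K : ℕ} (h : s ≤ K) :
    ∑ k ∈ Finset.Icc 1 K, (k : ℚ) * invFactorialPair s k =
      s / (2 * (s.factorial * s.factorial)) := by
  have h₀ : ((s : ℚ) - K) * invFactorialPair s K = 0 := by
    rcases h.eq_or_lt with rfl | h
    · simp
    · rw [invFactorialPair_of_lt h, mul_zero]
  rw [sum_mul_invFactorialPair_eq, h₀]
  simp only [invFactorialPair, Nat.zero_le, if_true, Nat.add_zero, Nat.sub_zero]
  have := Nat.factorial_ne_zero s
  field_simp
  ring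

/-- Write k² = (s+1)² - (s+1-k)(s+1+k); the product strips the top factor of each factorial. -/
theorem sq_mul_invFactorialPair_succ (s k : ℕ) :
    (k : ℚ) ^ 2 * invFactorialPair (s + 1) k =
      ((s + 1) ^ 2 : ℕ) * invFactorialPair (s + 1) k - invFactorialPair s k := by
  rcases lt_trichotomy k (s + 1) with h | rfl | h
  · obtain ⟨j, rfl⟩ := Nat.exists_eq_add_of_le (Nat.lt_succ_iff.1 h)
    rw [invFactorialPair_add, show k + j + 1 = k + (j + 1) by ring, invFactorialPair_add,
      show k + (j + 1) + k = (k + j + k) + 1 by ring, Nat.factorial_succ, Nat.factorial_succ]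
    have h₁ := Nat.factorial_ne_zero (k + j + k)
    have h₂ := Nat.factorial_ne_zero j
    push_cast
    field_simp
    ring
  · rw [invFactorialPair_of_lt (Nat.lt_succ_self s)]
    push_cast
    ring
  · rw [invFactorialPair_of_lt h, invFactorialPair_of_lt (by omega : s < k)]
    simp

theorem sq_mul_invFactorialPair_zero (k : ℕ) : (k : ℚ) ^ 2 * invFactorialPair 0 k = 0 := by
  rcases k.eq_zero_or_pos with rfl | h
  · simp
  · rw [invFactorialPair_of_lt h, mul_zero]

/-! ### Linearization of products -/

/-- A form of the Chu–Vandermonde identity. -/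
theorem choose_add_eq_sum_range {s k : ℕ} (l : ℕ) (h : k ≤ s) :
    (l + s).choose (s + k) =
      ∑ u ∈ Finset.range (s + 1), (s - k).choose (s - u) * (l + k).choose (u + k) := by
  rw [show l + s = (s - k) + (l + k) by omega, Nat.add_choose_eq,
    Finset.Nat.sum_antidiagonal_eq_sum_range_succ
      (fun i j => (s - k).choose i * (l + k).choose j),
    ← Finset.sum_range_reflect]
  symm
  rw [← Finset.sum_range_reflect]
  have h₁ : ∀ i ∈ Finset.range (s + 1),
      (s - k).choose (s - (s + 1 - 1 - i)) * (l + k).choose (s + 1 - 1 - i + k) =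
        (s - k).choose i * (l + k).choose (s + k - i) := by
    intro i hi
    rw [Finset.mem_range] at hi
    rw [show s - (s + 1 - 1 - i) = i by omega, show s + 1 - 1 - i + k = s + k - i by omega]
  rw [Finset.sum_congr rfl h₁,
    Finset.sum_range_reflect (fun i => (s - k).choose i * (l + k).choose (s + k - i))]
  refine Finset.sum_subset (fun i hi => ?_) (fun i _ hi => ?_)
  · rw [Finset.mem_range] at *
    omega
  · rw [Finset.mem_range] at hi
    rw [Nat.choose_eq_zero_of_lt (by omega), zero_mul]

/-- The guard `u ≤ l` is needed because truncated subtraction would turn `(l - u)!` into 1 instead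
of killing the term. -/
theorem invFactorialPair_mul (l s k : ℕ) :
    ((l + s).factorial : ℚ) * (invFactorialPair l k * invFactorialPair s k) =
      ∑ u ∈ Finset.range (s + 1), if u ≤ l then
        invFactorialPair u k / ((l - u).factorial * (s - u).factorial : ℚ) else 0 := by
  by_cases hk : k ≤ s ∧ k ≤ l
  · obtain ⟨hs, hl⟩ := hk
    have hc : ((l + s).factorial : ℚ) * (invFactorialPair l k * invFactorialPair s k) =
        ((l + s).choose (s + k) : ℚ) / ((l + k).factorial * (s - k).factorial) := by
      rw [Nat.cast_choose ℚ (by omega), show l + s - (s + k) = l - k by omega,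
        invFactorialPair, invFactorialPair, if_pos hl, if_pos hs]
      have h₁ := Nat.factorial_ne_zero (l + k)
      have h₂ := Nat.factorial_ne_zero (l - k)
      have h₃ := Nat.factorial_ne_zero (s + k)
      have h₄ := Nat.factorial_ne_zero (s - k)
      field_simp
    rw [hc, choose_add_eq_sum_range l hs, Nat.cast_sum, Finset.sum_div]
    refine Finset.sum_congr rfl fun u hu => ?_
    rw [Finset.mem_range] at hu
    split_ifs with hul
    · rcases le_or_gt k u with hku | hku
      · rw [Nat.cast_mul, Nat.cast_choose ℚ (by omega), Nat.cast_choose ℚ (by omega),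
          show s - k - (s - u) = u - k by omega, show l + k - (u + k) = l - u by omega,
          invFactorialPair, if_pos hku]
        have h₁ := Nat.factorial_ne_zero (l + k)
        have h₂ := Nat.factorial_ne_zero (s - k)
        have h₃ := Nat.factorial_ne_zero (s - u)
        have h₄ := Nat.factorial_ne_zero (u - k)
        have h₅ := Nat.factorial_ne_zero (u + k)
        have h₆ := Nat.factorial_ne_zero (l - u)
        field_simp
      · rw [invFactorialPair_of_lt hku, Nat.choose_eq_zero_of_lt (by omega)]
        simp
    · rw [Nat.choose_eq_zero_of_lt (by omega : l + k < u + k)]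
      simp
  · have h₀ : invFactorialPair l k * invFactorialPair s k = 0 := by
      rcases not_and_or.1 hk with h | h
      · rw [invFactorialPair_of_lt (not_le.1 h), mul_zero]
      · rw [invFactorialPair_of_lt (not_le.1 h), zero_mul]
    rw [h₀, mul_zero]
    refine (Finset.sum_eq_zero fun u hu => ?_).symm
    rw [Finset.mem_range] at hu
    split_ifs with hul
    · rw [invFactorialPair_of_lt (by omega), zero_div]
    · rfl

/-! ### Integral spans and the multiplications acting on them -/

/-- The function `k ↦ invFactorialPair s k / ((c - s)! (l - s)!)`. -/
def weightedPair (c l s k : ℕ) : ℚ :=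
  invFactorialPair s k / ((c - s).factorial * (l - s).factorial : ℚ)

/-- The additive group generated by the functions `weightedPair c l s` with `s ≤ c` and `s ≤ l`. -/
def weightedSpan (c l : ℕ) : AddSubgroup (ℕ → ℚ) :=
  AddSubgroup.closure {f | ∃ s, s ≤ c ∧ s ≤ l ∧ f = weightedPair c l s}

theorem weightedPair_mem {c l s : ℕ} (hc : s ≤ c) (hl : s ≤ l) :
    weightedPair c l s ∈ weightedSpan c l :=
  AddSubgroup.subset_closure ⟨s, hc, hl, rfl⟩

theorem invFactorialPair_mem (c : ℕ) : invFactorialPair c ∈ weightedSpan c c := by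
  have h := weightedPair_mem (le_refl c) (le_refl c)
  have e : weightedPair c c c = invFactorialPair c := by
    funext k
    simp [weightedPair]
  rwa [e] at h

/-- Multiplication by `g` maps the span into another one as soon as it does so on generators. -/
theorem mul_mem_weightedSpan {c l l' : ℕ} {g : ℕ → ℚ}
    (hg : ∀ s, s ≤ c → s ≤ l → g * weightedPair c l s ∈ weightedSpan c l')
    {f : ℕ → ℚ} (hf : f ∈ weightedSpan c l) : g * f ∈ weightedSpan c l' := by
  induction hf using AddSubgroup.closure_induction with
  | mem f hf =>
    obtain ⟨s, hc, hl, rfl⟩ := hf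
    exact hg s hc hl
  | zero => simp
  | add f₁ f₂ _ _ h₁ h₂ => rw [mul_add]; exact add_mem h₁ h₂
  | neg f _ h => rw [mul_neg]; exact neg_mem h

/-- The old weight's (l-s)! combines with (l+l')!/(l'+s)!, and its (c-s)! with (s-u)! and the new
(c-u)!, each into a binomial coefficient. -/
theorem factorial_mul_invFactorialPair_mul_mem {c l : ℕ} (l' : ℕ) {f : ℕ → ℚ}
    (hf : f ∈ weightedSpan c l) :
    (fun k => ((l + l').factorial : ℚ) * invFactorialPair l' k) * f ∈ weightedSpan c l' := by
  refine mul_mem_weightedSpan (fun s hc hl => ?_) hf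
  have e : (fun k => ((l + l').factorial : ℚ) * invFactorialPair l' k) * weightedPair c l s =
      ∑ u ∈ Finset.range (s + 1), if u ≤ l' then
        ((l + l').choose (l - s) * (c - u).choose (s - u)) • weightedPair c l' u else 0 := by
    funext k
    have h := invFactorialPair_mul l' s k
    have h₁ : (((l + l').factorial : ℚ) * invFactorialPair l' k) * weightedPair c l s k =
        ((l + l').choose (l - s) / (c - s).factorial : ℚ) *
          ((l' + s).factorial * (invFactorialPair l' k * invFactorialPair s k)) := by
      rw [Nat.cast_choose ℚ (by omega), show l + l' - (l - s) = l' + s by omega, weightedPair]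
      have h₁ := Nat.factorial_ne_zero (l' + s)
      have h₂ := Nat.factorial_ne_zero (c - s)
      have h₃ := Nat.factorial_ne_zero (l - s)
      field_simp
    rw [Pi.mul_apply, h₁, h, Finset.mul_sum, Finset.sum_apply]
    refine Finset.sum_congr rfl fun u hu => ?_
    rw [Finset.mem_range] at hu
    split_ifs with hul
    · rw [Pi.smul_apply, nsmul_eq_mul, Nat.cast_mul,
        Nat.cast_choose ℚ (by omega : s - u ≤ c - u),
        show c - u - (s - u) = c - s by omega, weightedPair]
      have h₁ := Nat.factorial_ne_zero (c - u)
      have h₂ := Nat.factorial_ne_zero (c - s)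
      have h₃ := Nat.factorial_ne_zero (s - u)
      have h₄ := Nat.factorial_ne_zero (l' - u)
      field_simp
    · simp
  rw [e]
  refine sum_mem fun u hu => ?_
  rw [Finset.mem_range] at hu
  split_ifs with hul
  · exact nsmul_mem (weightedPair_mem (by omega) hul) _
  · exact zero_mem _

theorem sq_mul_mem {c l : ℕ} {f : ℕ → ℚ} (hf : f ∈ weightedSpan c l) :
    (fun k : ℕ => (k : ℚ) ^ 2) * f ∈ weightedSpan c l := by
  refine mul_mem_weightedSpan (fun s hc hl => ?_) hf
  rcases s with _ | s
  · have e : (fun k : ℕ => (k : ℚ) ^ 2) * weightedPair c l 0 = 0 := by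
      funext k
      rw [Pi.mul_apply, weightedPair, ← mul_div_assoc, sq_mul_invFactorialPair_zero, zero_div]
      rfl
    rw [e]
    exact zero_mem _
  · have e : (fun k : ℕ => (k : ℚ) ^ 2) * weightedPair c l (s + 1) =
        ((s + 1) ^ 2) • weightedPair c l (s + 1) -
          ((c - s) * (l - s)) • weightedPair c l s := by
      funext k
      rw [Pi.mul_apply, Pi.sub_apply, Pi.smul_apply, Pi.smul_apply, nsmul_eq_mul, nsmul_eq_mul,
        weightedPair, weightedPair, ← mul_div_assoc, sq_mul_invFactorialPair_succ]
      obtain ⟨i, rfl⟩ := Nat.exists_eq_add_of_le hc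
      obtain ⟨j, rfl⟩ := Nat.exists_eq_add_of_le hl
      rw [show s + 1 + i - (s + 1) = i by omega, show s + 1 + j - (s + 1) = j by omega,
        show s + 1 + i - s = i + 1 by omega, show s + 1 + j - s = j + 1 by omega,
        Nat.factorial_succ, Nat.factorial_succ]
      have h₁ := Nat.factorial_ne_zero i
      have h₂ := Nat.factorial_ne_zero j
      push_cast
      field_simp
    rw [e]
    exact sub_mem (nsmul_mem (weightedPair_mem hc hl) _)
      (nsmul_mem (weightedPair_mem (by omega) (by omega)) _)

theorem pow_mul_mem {c l : ℕ} {g : ℕ → ℚ}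
    (hg : ∀ f ∈ weightedSpan c l, g * f ∈ weightedSpan c l) (m : ℕ) {f : ℕ → ℚ}
    (hf : f ∈ weightedSpan c l) : g ^ m * f ∈ weightedSpan c l := by
  induction m with
  | zero => simpa using hf
  | succ m ih =>
    rw [pow_succ', mul_assoc]
    exact hg _ ih

theorem centralChoose_pow_mul_mem {c l : ℕ} (m : ℕ) {f : ℕ → ℚ} (hf : f ∈ weightedSpan c l) :
    (fun k => ((2 * l).choose (l + k) : ℚ)) ^ m * f ∈ weightedSpan c l := by
  refine pow_mul_mem (fun f hf => ?_) m hf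
  have h := factorial_mul_invFactorialPair_mul_mem l hf
  simp_rw [← two_mul, ← centralChoose_eq] at h
  exact h

/-! ### Summation and divisibility -/

/-- The sum of `k * f k` over `f` in the span, up to the factor `c! l!`, is divisible by `d`. -/
theorem exists_factorial_mul_sum_eq {c l d K : ℕ} (hK : l ≤ K)
    (hd : ∀ s, 2 * d ∣ s * c.choose s * l.choose s) {f : ℕ → ℚ} (hf : f ∈ weightedSpan c l) :
    ∃ z : ℤ, (c.factorial * l.factorial : ℚ) * ∑ k ∈ Finset.Icc 1 K, (k : ℚ) * f k = d * z := by
  induction hf using AddSubgroup.closure_induction with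
  | mem f hf =>
    obtain ⟨s, hc, hl, rfl⟩ := hf
    obtain ⟨z, hz⟩ := hd s
    refine ⟨z, ?_⟩
    have hz' : (s * c.choose s * l.choose s : ℚ) = 2 * d * z := by exact_mod_cast hz
    simp_rw [weightedPair, ← mul_div_assoc]
    rw [← Finset.sum_div, sum_mul_invFactorialPair (hl.trans hK)]
    rw [Nat.cast_choose ℚ hc, Nat.cast_choose ℚ hl] at hz'
    have h₁ := Nat.factorial_ne_zero (c - s)
    have h₂ := Nat.factorial_ne_zero (l - s)
    have h₃ := Nat.factorial_ne_zero s
    rw [Int.cast_natCast, show (d * z : ℚ) = 2 * d * z / 2 by ring, ← hz']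
    field_simp
  | zero => exact ⟨0, by simp⟩
  | add f₁ f₂ _ _ h₁ h₂ =>
    obtain ⟨z₁, h₁⟩ := h₁
    obtain ⟨z₂, h₂⟩ := h₂
    refine ⟨z₁ + z₂, ?_⟩
    simp_rw [Pi.add_apply, mul_add]
    rw [Finset.sum_add_distrib, mul_add, h₁, h₂]
    push_cast
    ring
  | neg f _ h =>
    obtain ⟨z, h⟩ := h
    refine ⟨-z, ?_⟩
    simp_rw [Pi.neg_apply, mul_neg]
    rw [Finset.sum_neg_distrib, mul_neg, h]
    push_cast
    ring

/-- One factor of each binomial starts the product or moves the span along x, y, w; the remaining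
powers p, q, m preserve the current span. -/
theorem exists_factorial_mul_sum_central_eq {x y w d K : ℕ} (p q m a : ℕ) (hK : w ≤ K)
    (hd : ∀ s, 2 * d ∣ s * x.choose s * w.choose s) :
    ∃ z : ℤ, ((x + y).factorial * (y + w).factorial * (x.factorial * w.factorial) : ℚ) *
      ∑ k ∈ Finset.Icc 1 K, (k : ℚ) ^ (2 * a + 1) * (2 * x).choose (x + k) ^ (p + 1) *
        (2 * y).choose (y + k) ^ (q + 1) * (2 * w).choose (w + k) ^ (m + 1) =
      (2 * x).factorial * (2 * y).factorial * (2 * w).factorial * (d * z) := by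
  have h₁ := centralChoose_pow_mul_mem p (invFactorialPair_mem x)
  have h₂ := centralChoose_pow_mul_mem q (factorial_mul_invFactorialPair_mul_mem y h₁)
  have h₃ := centralChoose_pow_mul_mem m (factorial_mul_invFactorialPair_mul_mem w h₂)
  have h₄ := pow_mul_mem (fun f hf => sq_mul_mem hf) a h₃
  obtain ⟨z, hz⟩ := exists_factorial_mul_sum_eq hK hd h₄
  refine ⟨z, ?_⟩
  rw [← hz, Finset.mul_sum, Finset.mul_sum, Finset.mul_sum]
  refine Finset.sum_congr rfl fun k _ => ?_
  simp only [Pi.mul_apply, Pi.pow_apply]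
  rw [pow_succ _ p, pow_succ _ q, pow_succ _ m, pow_succ _ (2 * a), pow_mul]
  generalize ((k : ℚ) ^ 2) ^ a = e₀
  generalize hX : ((2 * x).choose (x + k) : ℚ) ^ p = X
  generalize hY : ((2 * y).choose (y + k) : ℚ) ^ q = Y
  generalize hW : ((2 * w).choose (w + k) : ℚ) ^ m = W
  rw [centralChoose_eq x, centralChoose_eq y, centralChoose_eq w]
  ring

theorem dvd_mul_choose (m s : ℕ) : m ∣ s * m.choose s := by
  rcases s with _ | s
  · simp
  rcases m with _ | m
  · simp
  · exact ⟨m.choose s, by rw [mul_comm, ← Nat.add_one_mul_choose_eq]⟩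

theorem corollary6p7 (r s t n a : ℕ) (hr : 0 < r) (hs : 0 < s) (ht : 0 < t) (hn : 0 < n) :
    n * (6 * n).choose n ∣
        ∑ k ∈ Finset.Icc 1 n, k ^ (2 * a + 1) * (6 * n).choose (3 * n + k) ^ r *
          (4 * n).choose (2 * n + k) ^ s * (2 * n).choose (n + k) ^ t ∧
      3 * n * (6 * n).choose (3 * n) ∣
        ∑ k ∈ Finset.Icc 1 n, k ^ (2 * a + 1) * (6 * n).choose (3 * n + k) ^ r *
          (4 * n).choose (2 * n + k) ^ s * (2 * n).choose (n + k) ^ t := by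
  obtain ⟨r, rfl⟩ := Nat.exists_eq_add_of_lt hr
  obtain ⟨s, rfl⟩ := Nat.exists_eq_add_of_lt hs
  obtain ⟨t, rfl⟩ := Nat.exists_eq_add_of_lt ht
  simp only [zero_add]
  have h₂ : 2 * (2 * n) = 4 * n := by ring
  have h₃ : 2 * (3 * n) = 6 * n := by ring
  have dvd₂ (v : ℕ) : 2 * n ∣ v * (2 * n).choose v := dvd_mul_choose _ _
  constructor
  -- In this order the factorials reduce to (6n)!/((5n)! n!).
  · obtain ⟨z, hz⟩ := exists_factorial_mul_sum_central_eq (x := 2 * n) (y := 3 * n) (w := n)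
      (d := n) s r t a le_rfl (fun v => (dvd₂ v).mul_right _)
    rw [h₂, h₃, show 2 * n + 3 * n = 5 * n by ring, show 3 * n + n = 4 * n by ring] at hz
    rw [← Int.natCast_dvd_natCast]
    refine ⟨z, ?_⟩
    rw [← Int.cast_inj (α := ℚ)]
    push_cast
    rw [Nat.cast_choose ℚ (by omega : n ≤ 6 * n), show 6 * n - n = 5 * n by omega]
    have f₁ : (n.factorial : ℚ) ≠ 0 := mod_cast Nat.factorial_ne_zero _
    have f₂ : ((2 * n).factorial : ℚ) ≠ 0 := mod_cast Nat.factorial_ne_zero _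
    have f₄ : ((4 * n).factorial : ℚ) ≠ 0 := mod_cast Nat.factorial_ne_zero _
    have f₅ : ((5 * n).factorial : ℚ) ≠ 0 := mod_cast Nat.factorial_ne_zero _
    have f : ((5 * n).factorial * (4 * n).factorial * ((2 * n).factorial * n.factorial) : ℚ) ≠ 0 :=
      by positivity
    refine mul_left_cancel₀ f (Eq.trans ?_ (hz.trans ?_))
    · congr 1
      exact Finset.sum_congr rfl fun k _ => by ring
    · field_simp
  · have hd (v : ℕ) : 2 * (3 * n) ∣ v * (3 * n).choose v * (2 * n).choose v := by
      have d₂ : 2 * n ∣ v * (3 * n).choose v * (2 * n).choose v := by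
        rw [mul_right_comm]
        exact (dvd₂ v).mul_right _
      have d₃ : 3 * n ∣ v * (3 * n).choose v * (2 * n).choose v :=
        (dvd_mul_choose _ _).mul_right _
      -- lcm(2n, 3n) = 6n supplies the extra factor 3.
      have := Nat.lcm_dvd d₂ d₃
      rw [Nat.lcm_mul_right] at this
      rw [← mul_assoc]
      exact this
    -- Here the factorials reduce to (6n)!/(3n)!². Ending at w = 2n forces the summation range up to
    -- 2n, where the added terms vanish.
    obtain ⟨z, hz⟩ := exists_factorial_mul_sum_central_eq (x := 3 * n) (y := n) (w := 2 * n)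
      (d := 3 * n) r t s a le_rfl hd
    rw [h₂, h₃, show 3 * n + n = 4 * n by ring, show n + 2 * n = 3 * n by ring] at hz
    have hsum : ∑ k ∈ Finset.Icc 1 n, k ^ (2 * a + 1) * (6 * n).choose (3 * n + k) ^ (r + 1) *
          (4 * n).choose (2 * n + k) ^ (s + 1) * (2 * n).choose (n + k) ^ (t + 1) =
        ∑ k ∈ Finset.Icc 1 (2 * n), k ^ (2 * a + 1) * (6 * n).choose (3 * n + k) ^ (r + 1) *
          (4 * n).choose (2 * n + k) ^ (s + 1) * (2 * n).choose (n + k) ^ (t + 1) := by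
      refine Finset.sum_subset (Finset.Icc_subset_Icc_right (by omega)) fun k hk hk' => ?_
      rw [Finset.mem_Icc] at hk hk'
      rw [Nat.choose_eq_zero_of_lt (by omega : 2 * n < n + k), zero_pow (by omega), mul_zero]
    rw [hsum, ← Int.natCast_dvd_natCast]
    refine ⟨z, ?_⟩
    rw [← Int.cast_inj (α := ℚ)]
    push_cast at hz ⊢
    rw [Nat.cast_choose ℚ (by omega : 3 * n ≤ 6 * n), show 6 * n - 3 * n = 3 * n by omega]
    have f₂ : ((2 * n).factorial : ℚ) ≠ 0 := mod_cast Nat.factorial_ne_zero _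
    have f₃ : ((3 * n).factorial : ℚ) ≠ 0 := mod_cast Nat.factorial_ne_zero _
    have f₄ : ((4 * n).factorial : ℚ) ≠ 0 := mod_cast Nat.factorial_ne_zero _
    have f : ((4 * n).factorial * (3 * n).factorial *
        ((3 * n).factorial * (2 * n).factorial) : ℚ) ≠ 0 := by positivity
    refine mul_left_cancel₀ f (Eq.trans ?_ (hz.trans ?_))
    · congr 1
      exact Finset.sum_congr rfl fun k _ => by ring
    · field_simp
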